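/- For a continuous map $p\colon E\to B$ let $\sec(p)\in\mathbb{N}\cup\{\infty\}$ be the least $n$ for which there are open sets $\emptyset=U_0\subseteq U_1\subseteq\cdots\subseteq U_n=B$ such that $p$ has a continuous partial section over each difference $U_i\setminus U_{i-1}$, $1\le i\le n$ (and $\sec(p)=\infty$ if there is no such $n$). For a space $X$ let $X^I$ be the space of all paths $[0,1]\to X$ with the compact-open topology. The topological complexity of a continuous surjection $f\colon X\to Y$ between path-connected spaces is $\mathrm{TC}(f)=\sec(\pi_f)$, where $\pi_f\colon X^I\to X\times Y$, $\pi_f(\alpha)=(\alpha(0),f(\alpha(1)))$; the topological complexity of a path-connected space $X$ is $\mathrm{TC}(X)=\sec(\pi)$, where $\pi\colon X^I\to X\times X$, $\pi(\alpha)=(\alpha(0),\alpha(1))$. Theorem. Let $(X,x_0)$ be a pointed path-connected CW complex. Every subgroup $G\le\pi_1(X,x_0)$ is the image $p_\sharp(\pi_1(\widetilde X,\tilde x_0))$ for some base-point preserving covering projection $p\colon(\widetilde X,\tilde x_0)\to(X,x_0)$ with path-connected total space; in particular $X$ has a universal (simply connected) covering. The number $\mathrm{TC}(p)$ depends only on $G=\mathrm{im}(p_\sharp)$,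 and the resulting function $G\mapsto\mathrm{TC}(p_G)$ from the lattice of subgroups of $\pi_1(X,x_0)$ to $\mathbb{N}\cup\{\infty\}$ is increasing: if $G\le G'$, then $\mathrm{TC}(p_G)\le\mathrm{TC}(p_{G'})$. Its minimal value is attained at the trivial subgroup and is the topological complexity of the universal covering projection of $X$; its maximal value is attained at $\pi_1(X,x_0)$, where it equals $\mathrm{TC}(\mathrm{id}_X)=\mathrm{TC}(X)$. -/

import Mathlib

universe u

namespace CoveringTC

section SectionalNumber

variable {E B : Type*} [TopologicalSpace E] [TopologicalSpace B]

/-- The map `p : E → B` admits a continuous partial section over the subspace `A ⊆ B`. -/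
def HasPartialSection (p : E → B) (A : Set B) : Prop :=
  ∃ s : A → E, Continuous s ∧ ∀ a : A, p (s a) = a

/-- There is an increasing sequence `∅ = U 0 ⊆ U 1 ⊆ ⋯ ⊆ U n = B` of open subsets of `B` such that
`p` admits a continuous partial section over each difference `U (i + 1) \ U i`. -/
def HasSectionalFiltration (p : E → B) (n : ℕ) : Prop :=
  ∃ U : Fin (n + 1) → Set B,
    U 0 = ∅ ∧ U (Fin.last n) = Set.univ ∧ Monotone U ∧ (∀ i, IsOpen (U i)) ∧
      ∀ i : Fin n, HasPartialSection p (U i.succ \ U i.castSucc)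

/-- The sectional number of `p`: the least `n` for which there is a filtration as in
`HasSectionalFiltration`, and `∞` if there is none. -/
noncomputable def sectionalNumber (p : E → B) : ℕ∞ :=
  ⨅ (n : ℕ) (_ : HasSectionalFiltration p n), (n : ℕ∞)

end SectionalNumber

section TopologicalComplexity

/-- The topological complexity of the space `X`: the sectional number of
`X^I → X × X, α ↦ (α 0, α 1)`, where `X^I = C(unitInterval, X)` has the compact-open topology. -/
noncomputable def spaceTC (X : Type*) [TopologicalSpace X] : ℕ∞ :=
  sectionalNumber (fun α : C(unitInterval, X) => (α 0, α 1))

/-- The topological complexity of the map `f : X → Y`: the sectional number of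
`X^I → X × Y, α ↦ (α 0, f (α 1))`. -/
noncomputable def mapTC {X Y : Type*} [TopologicalSpace X] [TopologicalSpace Y] (f : C(X, Y)) :
    ℕ∞ :=
  sectionalNumber (fun α : C(unitInterval, X) => (α 0, f (α 1)))

end TopologicalComplexity

/-- A base-point preserving covering projection over `(X, x₀)` with path-connected total space. -/
structure PointedCovering (X : Type u) [TopologicalSpace X] (x₀ : X) where
  /-- the total space -/
  Total : Type u
  [topology : TopologicalSpace Total]
  [pathConnected : PathConnectedSpace Total]
  /-- the base point of the total space -/
  base : Total
  /-- the covering projection -/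
  proj : C(Total, X)
  isCoveringMap : IsCoveringMap proj
  proj_base : proj base = x₀

attribute [instance] PointedCovering.topology PointedCovering.pathConnected

/-- The image of the homomorphism induced by a pointed covering projection on fundamental
groups. -/
noncomputable def PointedCovering.subgroup {X : Type u} [TopologicalSpace X] {x₀ : X}
    (p : PointedCovering X x₀) : Subgroup (FundamentalGroup X x₀) :=
  (FundamentalGroup.mapOfEq p.proj p.proj_base).range

end CoveringTC

/-!
The theorem has two independent ingredients.

*Monotonicity.* If `G ≤ G'`, the lifting criterion factors the covering `p_G` as `p_{G'} ∘ q`.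
A motion planner for `p_{G'}` over `A` gives one for `p_G` over `(q × id)⁻¹(A)`: the planned path is
projected to `X` and lifted to the total space of `p_G` with the prescribed starting point, which is
continuous by the homotopy lifting property (`HasPartialSection.of_factorization`). Hence
`TC(p_G) ≤ TC(p_{G'})`, and two coverings with the same subgroup have the same complexity
(`PointedCovering.mapTC_mono`). The identity covering has the whole group as its subgroup, and
`TC(id)` is `TC(X)` by definition.

*Existence of coverings.* The covering of `G` is the set of paths starting at `x₀`, two paths being
identified when they have the same endpoint and differ by an element of `G` up to homotopy. A set
is open if it is stable under short extensions of paths. Over an open path-connected set in which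
parallel paths are homotopic in `X` this is a product (`PathCover.isEvenlyCovered`), and the lift of
a path `γ` is the path of its initial parts, so that a loop lifts to a loop exactly if its class
lies in `G` (`exists_pointedCovering`).

This needs a locally path-connected and semilocally simply connected base. A CW complex is a
quotient of a disjoint union of balls, which gives the first property. For the second, an open cell
is thickened to an open set `StarNhd` by adding, skeleton by skeleton, the outer halves of the cones
over what is already there. A loop in this set lies in some skeleton by compactness
(`exists_subset_skeletonLT`), and radial projection to the boundaries of the cells of top dimension
homotopes it into the next lower skeleton, until it lies in the open cell, which is contractible
(`homotopic_refl_of_range_subset_starNhd`). Only finitely many homotopies are needed for each loop,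
so no contraction of the whole neighbourhood has to be constructed.
-/

/-! ### Lifting motion planners through coverings -/

namespace CoveringTC

open Topology Set
open scoped unitInterval

/-- The source of a local homeomorphism to a locally path-connected space is locally
path-connected. -/
theorem _root_.IsLocalHomeomorph.locallyPathConnectedSpace {E X : Type*} [TopologicalSpace E]
    [TopologicalSpace X] [LocallyPathConnectedSpace X] {p : E → X} (hp : IsLocalHomeomorph p) :
    LocallyPathConnectedSpace E := by
  rw [locallyPathConnectedSpace_iff_pathComponentIn_mem_nhds]
  intro x u hu hx
  obtain ⟨φ, hxφ, rfl⟩ := hp x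
  have h1 : LocallyPathConnectedSpace φ.target := φ.open_target.locallyPathConnectedSpace
  have h2 : LocallyPathConnectedSpace φ.source :=
    φ.toHomeomorphSourceTarget.isOpenEmbedding.locallyPathConnectedSpace
  have h3 := h2.path_connected_basis ⟨x, hxφ⟩
  obtain ⟨s, ⟨hs, hsc⟩, hsu⟩ := h3.mem_iff.1
    ((hu.preimage continuous_subtype_val).mem_nhds (show (⟨x, hxφ⟩ : φ.source) ∈ _ from hx))
  have h4 : Subtype.val '' s ∈ 𝓝 x :=
    φ.open_source.isOpenEmbedding_subtypeVal.image_mem_nhds.2 hs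
  refine Filter.mem_of_superset h4 ?_
  exact (hsc.image continuous_subtype_val).subset_pathComponentIn (mem_of_mem_nhds h4)
    (image_subset_iff.2 hsu)

/-- If a covering `p` factors through a covering `p'` of the same space, the factorization being
`q`, then a motion planner for `p'` over a set `A` gives one for `p` over `(q × id)⁻¹(A)`: apply the
planner for `p'`, project the path to the base and lift it with the prescribed starting point. -/
theorem HasPartialSection.of_factorization {E E' X : Type*} [TopologicalSpace E]
    [TopologicalSpace E'] [TopologicalSpace X] {p : C(E, X)} (hp : IsCoveringMap p) {p' : C(E', X)}
    (q : C(E, E')) (hq : ∀ e, p' (q e) = p e) {A : Set (E' × X)}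
    (h : HasPartialSection (fun α : C(I, E') => (α 0, p' (α 1))) A) :
    HasPartialSection (fun α : C(I, E) => (α 0, p (α 1))) (Prod.map q id ⁻¹' A) := by
  obtain ⟨s, hs, hs'⟩ := h
  let r : C(↥(Prod.map q id ⁻¹' A), A) :=
    ⟨fun a => ⟨Prod.map q id a.1, a.2⟩, by fun_prop⟩
  let H : C(I × ↥(Prod.map q id ⁻¹' A), X) :=
    ⟨fun ta => p' (s (r ta.2) ta.1), by fun_prop⟩
  let f : C(↥(Prod.map q id ⁻¹' A), E) := ⟨fun a => a.1.1, by fun_prop⟩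
  have H0 : ∀ a, H (0, a) = p (f a) := by
    intro a
    have := congrArg Prod.fst (hs' (r a))
    change p' (s (r a) 0) = p a.1.1
    rw [show s (r a) 0 = q a.1.1 from this, hq]
  let L := hp.liftHomotopy H f H0
  let L' : C(↥(Prod.map q id ⁻¹' A), C(I, E)) := (L.comp .prodSwap).curry
  refine ⟨L', L'.continuous, fun a => Prod.ext ?_ ?_⟩
  · exact hp.liftHomotopy_zero H f H0 a
  · have h1 : p (L (1, a)) = H (1, a) := congrFun (hp.liftHomotopy_lifts H f H0) (1, a)
    exact h1.trans (congrArg Prod.snd (hs' (r a)))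

theorem mapTC_le_of_factorization {E E' X : Type*} [TopologicalSpace E]
    [TopologicalSpace E'] [TopologicalSpace X] {p : C(E, X)} (hp : IsCoveringMap p) {p' : C(E', X)}
    (q : C(E, E')) (hq : ∀ e, p' (q e) = p e) : mapTC p ≤ mapTC p' := by
  refine le_iInf₂ fun n hn => iInf₂_le n ?_
  obtain ⟨U, h0, h1, hm, ho, hs⟩ := hn
  refine ⟨fun i => Prod.map q id ⁻¹' U i, by simp [h0], by simp [h1],
    fun i j hij => preimage_mono (hm hij), fun i => (ho i).preimage (by fun_prop), fun i => ?_⟩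
  exact (hs i).of_factorization hp q hq

namespace PointedCovering

variable {X : Type u} [TopologicalSpace X] {x₀ : X}

/-- The lifting criterion, for two pointed coverings of a locally path-connected space. -/
theorem exists_factorization [LocallyPathConnectedSpace X] (p p' : PointedCovering X x₀)
    (h : p.subgroup ≤ p'.subgroup) : ∃ q : C(p.Total, p'.Total), ∀ e, p'.proj (q e) = p.proj e := by
  obtain ⟨T, b, f, hf, hb⟩ := p
  subst hb
  have := hf.isLocalHomeomorph.locallyPathConnectedSpace
  obtain ⟨q, ⟨-, hq⟩, -⟩ := p'.isCoveringMap.existsUnique_continuousMap_lifts_of_range_le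
    (f := f) (a₀ := b) p'.proj_base (by
      refine le_trans (le_of_eq ?_) h
      refine congrArg MonoidHom.range (MonoidHom.ext fun γ => ?_)
      rw [FundamentalGroup.mapOfEq_apply, Path.Homotopic.Quotient.cast_rfl_rfl]
      rfl)
  exact ⟨q, congrFun hq⟩

theorem mapTC_mono [LocallyPathConnectedSpace X] (p p' : PointedCovering X x₀)
    (h : p.subgroup ≤ p'.subgroup) : mapTC p.proj ≤ mapTC p'.proj :=
  have ⟨q, hq⟩ := p.exists_factorization p' h
  mapTC_le_of_factorization p.isCoveringMap q hq

/-- The identity map, as a pointed covering. -/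
def refl [PathConnectedSpace X] (x₀ : X) : PointedCovering X x₀ where
  Total := X
  base := x₀
  proj := ContinuousMap.id X
  isCoveringMap x :=
    have h : IsEvenlyCovered (id : X → X) x Unit := ⟨inferInstance, univ, trivial, isOpen_univ,
      isOpen_univ, (Homeomorph.prodPUnit _).symm, fun _ => rfl⟩
    h.to_isEvenlyCovered_preimage
  proj_base := rfl

theorem subgroup_eq_bot (p : PointedCovering X x₀) [SimplyConnectedSpace p.Total] :
    p.subgroup = ⊥ := by
  rw [eq_bot_iff]
  rintro _ ⟨γ, rfl⟩
  rw [Subsingleton.elim γ 1, map_one]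
  exact Subgroup.one_mem _

/-- Membership in the subgroup in terms of paths, with the equality of base points absorbed in a
cast. -/
theorem mem_subgroup_iff (p : PointedCovering X x₀) (γ : Path x₀ x₀) :
    FundamentalGroup.fromPath (.mk γ) ∈ p.subgroup ↔ ∃ Γ : Path p.base p.base,
      (Path.Homotopic (Γ.map p.proj.continuous) (γ.cast p.proj_base p.proj_base)) := by
  obtain ⟨T, b, f, hf, hb⟩ := p
  subst hb
  constructor
  · rintro ⟨Γ, hΓ⟩
    induction Γ using Path.Homotopic.Quotient.ind with | mk Γ => ?_
    rw [FundamentalGroup.mapOfEq_apply, Path.Homotopic.Quotient.cast_rfl_rfl] at hΓ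
    exact ⟨Γ, Path.Homotopic.Quotient.exact hΓ⟩
  · rintro ⟨Γ, hΓ⟩
    refine ⟨FundamentalGroup.fromPath (.mk Γ), ?_⟩
    rw [FundamentalGroup.mapOfEq_apply, Path.Homotopic.Quotient.cast_rfl_rfl]
    exact Path.Homotopic.Quotient.eq.2 hΓ

theorem subgroup_refl [PathConnectedSpace X] (x₀ : X) : (refl x₀).subgroup = ⊤ := by
  rw [eq_top_iff]
  rintro (γ : Path.Homotopic.Quotient x₀ x₀) -
  induction γ using Path.Homotopic.Quotient.ind with | mk γ => ?_
  exact ((refl x₀).mem_subgroup_iff γ).2 ⟨γ, .refl _⟩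

/-- A covering induces an injection on fundamental groups, so one with trivial subgroup is
universal. -/
theorem simplyConnectedSpace_of_subgroup_eq_bot (p : PointedCovering X x₀) (h : p.subgroup = ⊥) :
    SimplyConnectedSpace p.Total := by
  obtain ⟨T, b, f, hf, hb⟩ := p
  subst hb
  have h1 : Subsingleton (FundamentalGroup _ b) := by
    refine ⟨fun γ γ' => hf.injective_path_homotopic_map b b ?_⟩
    have key : ∀ γ : FundamentalGroup _ b, FundamentalGroup.mapOfEq f rfl γ = 1 := fun γ =>
      Subgroup.mem_bot.1 (h ▸ (⟨γ, rfl⟩ : _ ∈ (FundamentalGroup.mapOfEq f rfl).range))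
    have := (key γ).trans (key γ').symm
    rwa [FundamentalGroup.mapOfEq_apply, FundamentalGroup.mapOfEq_apply,
      Path.Homotopic.Quotient.cast_rfl_rfl, Path.Homotopic.Quotient.cast_rfl_rfl] at this
  refine simply_connected_iff_loops_nullhomotopic.2 ⟨inferInstance, fun x γ => ?_⟩
  have h2 : Subsingleton (FundamentalGroup _ x) :=
    (FundamentalGroup.fundamentalGroupMulEquivOfPathConnected x b).toEquiv.subsingleton
  exact Path.Homotopic.Quotient.exact (Subsingleton.elim
    (FundamentalGroup.fromPath (.mk γ)) (FundamentalGroup.fromPath (.mk (.refl x))))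

end PointedCovering

end CoveringTC

/-! ### The covering associated with a subgroup -/

namespace CoveringTC

open Topology Set
open scoped unitInterval

variable {X : Type u} [TopologicalSpace X] {x₀ : X}

/-- An open path-connected set `U` any two parallel paths of which are homotopic in the ambient
space; such sets are evenly covered by every covering constructed from path classes. -/
structure IsRelativelySimplyConnected (U : Set X) : Prop where
  isOpen : IsOpen U
  isPathConnected : IsPathConnected U
  homotopic : ∀ {y z : X} (γ δ : Path y z), range γ ⊆ U → range δ ⊆ U → γ.Homotopic δ

theorem _root_.Path.Homotopic.Quotient.trans_symm_trans {y z w : X}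
    (a : Path.Homotopic.Quotient y z) (b : Path.Homotopic.Quotient y w) :
    a.trans (a.symm.trans b) = b := by
  rw [← Path.Homotopic.Quotient.trans_assoc]; simp

theorem _root_.Path.Homotopic.Quotient.symm_trans_trans {y z w : X}
    (a : Path.Homotopic.Quotient y z) (b : Path.Homotopic.Quotient z w) :
    a.symm.trans (a.trans b) = b := by
  rw [← Path.Homotopic.Quotient.trans_assoc]; simp

section PathCover

variable (G : Subgroup (FundamentalGroup X x₀))

/-- Two paths from `x₀` to `y` are identified if going along the first and back along the second
gives a loop whose class lies in `G`. -/
def pathSetoid (y : X) : Setoid (Path x₀ y) where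
  r γ δ := FundamentalGroup.fromPath (.mk (γ.trans δ.symm)) ∈ G
  iseqv := by
    refine ⟨fun γ => ?_, fun {γ δ} h => ?_, fun {γ δ ε} h h' => ?_⟩
    · have h : Path.Homotopic.Quotient.mk (γ.trans γ.symm) = .refl x₀ := by simp
      rw [h]
      exact G.one_mem
    · convert G.inv_mem h
      rw [FundamentalGroup.inv_def]
      change _ = Path.Homotopic.Quotient.mk (γ.trans δ.symm).symm
      rw [Path.trans_symm, Path.symm_symm]
    · have h1 : Path.Homotopic.Quotient.mk (γ.trans ε.symm) =
          (Path.Homotopic.Quotient.mk (γ.trans δ.symm)).trans (.mk (δ.trans ε.symm)) := by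
        simp [Path.Homotopic.Quotient.symm_trans_trans]
      rw [h1]
      exact G.mul_mem h' h

/-- The fibre over `y` of the covering associated with `G`. -/
def Fiber (y : X) : Type u := Quotient (pathSetoid G y)

/-- The fibres carry the discrete topology, not the quotient of the compact-open topology. -/
instance (y : X) : TopologicalSpace (Fiber G y) := ⊥

instance (y : X) : DiscreteTopology (Fiber G y) := ⟨rfl⟩

/-- The total space of the covering associated with `G`: the classes, modulo `G`, of the paths
starting at `x₀`. -/
structure PathCover where
  /-- the endpoint of the path -/
  point : X
  /-- the class of the path -/
  cls : Fiber G point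

namespace PathCover

variable {G}

/-- The point of the covering given by a path from `x₀`. -/
def ofPath {y : X} (γ : Path x₀ y) : PathCover G := ⟨y, Quotient.mk _ γ⟩

theorem ofPath_eq_iff {y : X} {γ δ : Path x₀ y} :
    (ofPath γ : PathCover G) = ofPath δ ↔ FundamentalGroup.fromPath (.mk (γ.trans δ.symm)) ∈ G := by
  exact ⟨fun h => Quotient.exact (eq_of_heq (PathCover.mk.inj h).2),
    fun h => congrArg (PathCover.mk y) (Quotient.sound h)⟩

theorem ofPath_surjective (e : PathCover G) : ∃ γ : Path x₀ e.point, ofPath γ = e := by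
  obtain ⟨y, a⟩ := e
  induction a using Quotient.inductionOn with | h γ => exact ⟨γ, rfl⟩

theorem pathSetoid_of_homotopic {y : X} {γ δ : Path x₀ y} (h : γ.Homotopic δ) :
    pathSetoid G y γ δ := by
  have h1 : Path.Homotopic.Quotient.mk (γ.trans δ.symm) = .refl x₀ := by
    rw [Path.Homotopic.Quotient.mk_trans, Path.Homotopic.Quotient.eq.2 h]
    simp
  change _ ∈ G
  rw [h1]
  exact G.one_mem

theorem ofPath_eq_of_homotopic {y : X} {γ δ : Path x₀ y} (h : γ.Homotopic δ) :
    (ofPath γ : PathCover G) = ofPath δ :=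
  ofPath_eq_iff.2 (pathSetoid_of_homotopic h)

theorem ofPath_cast {y z : X} (γ : Path x₀ y) (h : z = y) :
    (ofPath (γ.cast rfl h) : PathCover G) = ofPath γ := by
  subst h; rfl

/-- Transport between the fibres along a path, by extending representatives. -/
noncomputable def transport {y z : X} (δ : Path y z) : Fiber G y → Fiber G z :=
  Quotient.map (fun γ => γ.trans δ) (by
    intro γ γ' h
    have h1 : Path.Homotopic.Quotient.mk ((γ.trans δ).trans (γ'.trans δ).symm) =
        .mk (γ.trans γ'.symm) := by
      simp [Path.Homotopic.Quotient.trans_symm_trans]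
    change _ ∈ G
    rw [h1]
    exact h)

theorem transport_transport_symm {y z : X} (δ : Path y z) (a : Fiber G z) :
    transport δ (transport δ.symm a) = a := by
  induction a using Quotient.inductionOn with | h γ => ?_
  refine Quotient.sound (pathSetoid_of_homotopic (Path.Homotopic.Quotient.exact ?_))
  simp

theorem transport_symm_transport {y z : X} (δ : Path y z) (a : Fiber G y) :
    transport δ.symm (transport δ a) = a := by
  induction a using Quotient.inductionOn with | h γ => ?_
  refine Quotient.sound (pathSetoid_of_homotopic (Path.Homotopic.Quotient.exact ?_))
  simp

/-- A set of path classes is open if, with each class of a path `γ` ending at `y`, it contains the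
classes of all extensions of `γ` by paths that stay in some neighbourhood of `y`. -/
instance : TopologicalSpace (PathCover G) where
  IsOpen W := ∀ (y : X) (γ : Path x₀ y), ofPath γ ∈ W → ∃ O ∈ 𝓝 y, ∀ (z : X) (δ : Path y z),
    range δ ⊆ O → ofPath (γ.trans δ) ∈ W
  isOpen_univ _ _ _ := ⟨univ, Filter.univ_mem, fun _ _ _ => trivial⟩
  isOpen_inter W W' h h' y γ hγ := by
    obtain ⟨O, hO, H⟩ := h y γ hγ.1
    obtain ⟨O', hO', H'⟩ := h' y γ hγ.2
    exact ⟨O ∩ O', Filter.inter_mem hO hO', fun z δ hδ =>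
      ⟨H z δ (hδ.trans inter_subset_left), H' z δ (hδ.trans inter_subset_right)⟩⟩
  isOpen_sUnion S h y γ := by
    rintro ⟨W, hW, hγ⟩
    obtain ⟨O, hO, H⟩ := h W hW y γ hγ
    exact ⟨O, hO, fun z δ hδ => ⟨W, hW, H z δ hδ⟩⟩

theorem isOpen_iff {W : Set (PathCover G)} :
    IsOpen W ↔ ∀ (y : X) (γ : Path x₀ y), ofPath γ ∈ W → ∃ O ∈ 𝓝 y, ∀ (z : X) (δ : Path y z),
      range δ ⊆ O → ofPath (γ.trans δ) ∈ W := Iff.rfl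

theorem continuous_point : Continuous (point : PathCover G → X) := by
  refine ⟨fun V hV => isOpen_iff.2 fun y γ hγ => ⟨V, hV.mem_nhds hγ, fun z δ hδ => ?_⟩⟩
  exact hδ ⟨1, δ.target⟩

section Chart

-- `ρ` chooses paths inside `U` to the reference point `y₀`; transport along them trivializes the
-- covering over `U`
variable {U : Set X} {y₀ : X} (ρ : ∀ z ∈ U, Path z y₀)

/-- The sheet over `U` through the point `a` of the fibre over `y₀` is open: it is stable under
extension by paths in `U`, since parallel paths in `U` are homotopic. -/
theorem isOpen_transport_fiber (hU : IsRelativelySimplyConnected U)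
    (hρ : ∀ z hz, range (ρ z hz) ⊆ U) (a : Fiber G y₀) :
    IsOpen {e : PathCover G | ∃ h : e.point ∈ U, transport (ρ e.point h) e.cls = a} := by
  rintro y γ ⟨hy, rfl⟩
  refine ⟨U, hU.isOpen.mem_nhds hy, fun z δ hδ => ⟨hδ ⟨1, δ.target⟩, ?_⟩⟩
  have hz : z ∈ U := hδ ⟨1, δ.target⟩
  refine Quotient.sound (pathSetoid_of_homotopic ?_)
  refine (Path.Homotopic.trans_assoc γ δ (ρ z hz)).trans ((Path.Homotopic.refl _).hcomp ?_)
  exact hU.homotopic _ _ (by rw [Path.trans_range]; exact union_subset hδ (hρ z hz)) (hρ y hy)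

/-- The section over `U` through the point `a` of the fibre over `y₀` is continuous. -/
theorem continuous_transport_symm [LocallyPathConnectedSpace X]
    (hU : IsRelativelySimplyConnected U)
    (hρ : ∀ z hz, range (ρ z hz) ⊆ U) (a : Fiber G y₀) :
    Continuous fun z : U => (⟨z, transport (ρ z z.2).symm a⟩ : PathCover G) := by
  refine ⟨fun W hW => isOpen_iff_mem_nhds.2 fun z hz => ?_⟩
  induction a using Quotient.inductionOn with | h γ => ?_
  change ofPath (γ.trans (ρ z z.2).symm) ∈ W at hz
  obtain ⟨O, hO, H⟩ := isOpen_iff.1 hW _ _ hz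
  have h1 := pathComponentIn_mem_nhds (Filter.inter_mem hO (hU.isOpen.mem_nhds z.2))
  filter_upwards [preimage_coe_mem_nhds_subtype.2 (mem_nhdsWithin_of_mem_nhds h1)] with z' hz'
  change ofPath (γ.trans (ρ z' z'.2).symm) ∈ W
  obtain ⟨δ, hδ⟩ := hz'
  have hδ' : range δ ⊆ O ∩ U := range_subset_iff.2 hδ
  convert H z' δ (hδ'.trans inter_subset_left) using 1
  refine ofPath_eq_of_homotopic ?_
  refine Path.Homotopic.trans ?_ (Path.Homotopic.trans_assoc γ (ρ z z.2).symm δ).symm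
  refine (Path.Homotopic.refl _).hcomp (hU.homotopic _ _ ?_ ?_)
  · rw [Path.symm_range]; exact hρ _ _
  · rw [Path.trans_range, Path.symm_range]
    exact union_subset (hρ _ _) (hδ'.trans inter_subset_right)

theorem isEvenlyCovered [LocallyPathConnectedSpace X]
    (hU : IsRelativelySimplyConnected U) (hy₀ : y₀ ∈ U) :
    IsEvenlyCovered (point : PathCover G → X) y₀ (Fiber G y₀) := by
  have hj : ∀ z ∈ U, JoinedIn U z y₀ := fun z hz => hU.isPathConnected.joinedIn z hz y₀ hy₀
  choose ρ hρ using hj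
  have hρ' : ∀ z hz, range (ρ z hz) ⊆ U := fun z hz => range_subset_iff.2 (hρ z hz)
  refine ⟨inferInstance, U, hy₀, hU.isOpen, hU.isOpen.preimage continuous_point,
    { toFun e := (⟨e.1.point, e.2⟩, transport (ρ e.1.point e.2) e.1.cls)
      invFun za := ⟨⟨za.1, transport (ρ za.1 za.1.2).symm za.2⟩, za.1.2⟩
      left_inv e := ?_
      right_inv za := ?_
      continuous_toFun := ?_
      continuous_invFun := ?_ }, fun _ => rfl⟩
  · exact Subtype.ext (congrArg (PathCover.mk _) (transport_symm_transport _ _))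
  · exact Prod.ext rfl (transport_transport_symm _ _)
  · refine (continuous_point.comp continuous_subtype_val).subtype_mk _ |>.prodMk ?_
    refine continuous_discrete_rng.2 fun a => ?_
    convert (isOpen_transport_fiber ρ hU hρ' a).preimage continuous_subtype_val using 1
    ext e
    exact ⟨fun h => ⟨e.2, h⟩, fun ⟨_, h⟩ => h⟩
  · refine Continuous.subtype_mk (continuous_prod_of_discrete_right.2 fun a => ?_) _
    exact continuous_transport_symm ρ hU hρ' a

end Chart

/-- The lift of a path `γ` starting at `x₀`: at time `t`, the class of the initial part of `γ`. -/
def lift {y : X} (γ : Path x₀ y) (t : I) : PathCover G :=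
  ofPath ((γ.subpath 0 t).cast γ.source.symm rfl)

theorem continuous_lift {y : X} (γ : Path x₀ y) : Continuous (lift γ : I → PathCover G) := by
  refine ⟨fun W hW => isOpen_iff_mem_nhds.2 fun t ht => ?_⟩
  obtain ⟨O, hO, H⟩ := isOpen_iff.1 hW _ _ ht
  obtain ⟨ε, hε, hb⟩ := Metric.mem_nhds_iff.1 (γ.continuous.continuousAt hO)
  filter_upwards [Metric.ball_mem_nhds t hε] with t' ht'
  have hr : range (γ.subpath t t') ⊆ O := by
    rw [Path.range_subpath]
    rintro _ ⟨s, hs, rfl⟩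
    refine hb (Metric.mem_ball.2 (lt_of_le_of_lt ?_ ht'))
    exact abs_sub_left_of_mem_uIcc (show (s : ℝ) ∈ uIcc (t : ℝ) t' from hs)
  change (lift γ t' : PathCover G) ∈ W
  refine mem_of_eq_of_mem (ofPath_eq_of_homotopic ?_).symm (H _ (γ.subpath t t') hr)
  have h1 : ((γ.subpath 0 t).trans (γ.subpath t t')).Homotopic (γ.subpath 0 t') :=
    ⟨Path.Homotopy.subpathTransSubpath γ 0 t t'⟩
  exact h1.pathCast γ.source.symm rfl

theorem lift_zero {y : X} (γ : Path x₀ y) : (lift γ 0 : PathCover G) = ofPath (.refl x₀) := by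
  rw [← ofPath_cast (.refl x₀) γ.source, lift, Path.subpath_self]
  congr 1
  ext
  simp

theorem lift_one {y : X} (γ : Path x₀ y) : (lift γ 1 : PathCover G) = ofPath γ := by
  rw [lift, Path.subpath_zero_one]
  exact ofPath_cast γ γ.target

/-- A path in the covering is the lift of its projection, by uniqueness of lifts. -/
theorem lift_map_point (h : IsCoveringMap (point : PathCover G → X)) {e : PathCover G}
    (Γ : Path (ofPath (.refl x₀)) e) :
    lift (y := e.point) (x₀ := x₀) (Γ.map continuous_point) = Γ :=
  h.eq_of_comp_eq (continuous_lift _) Γ.continuous rfl 0 ((lift_zero _).trans Γ.source.symm)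

end PathCover

open PathCover in
/-- Every subgroup of the fundamental group of a path-connected, locally path-connected and
semilocally simply connected space comes from a covering. -/
theorem exists_pointedCovering [PathConnectedSpace X] [LocallyPathConnectedSpace X]
    (hX : ∀ x : X, ∃ U : Set X, x ∈ U ∧ IsRelativelySimplyConnected U) :
    ∃ p : PointedCovering X x₀, p.subgroup = G := by
  have hcov : IsCoveringMap (point : PathCover G → X) := fun x =>
    have ⟨_, hx, hU⟩ := hX x
    (isEvenlyCovered hU hx).to_isEvenlyCovered_preimage
  have hpc : PathConnectedSpace (PathCover G) := by
    refine pathConnectedSpace_iff_eq.2 ⟨ofPath (.refl x₀), eq_univ_of_forall fun e => ?_⟩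
    obtain ⟨γ, hγ⟩ := ofPath_surjective e
    exact ⟨⟨⟨lift γ, continuous_lift γ⟩, lift_zero γ, (lift_one γ).trans hγ⟩⟩
  refine ⟨⟨PathCover G, ofPath (.refl x₀), ⟨point, continuous_point⟩, hcov, rfl⟩, ?_⟩
  -- a loop lies in `G` exactly if its lift, whose endpoint is the class of the loop, is closed
  have hG : ∀ γ : Path x₀ x₀, FundamentalGroup.fromPath (.mk γ) ∈ G ↔
      (lift γ 1 : PathCover G) = ofPath (.refl x₀) := fun γ => by
    rw [lift_one, ofPath_eq_iff, Path.refl_symm]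
    simp
  ext γ
  induction γ using Path.Homotopic.Quotient.ind with | mk γ => ?_
  refine (PointedCovering.mem_subgroup_iff _ γ).trans ⟨?_, fun h => ?_⟩
  · rintro ⟨Γ, hΓ⟩
    have h1 : Path.Homotopic.Quotient.mk γ = .mk (Γ.map continuous_point) :=
      (Path.Homotopic.Quotient.eq.2 hΓ).symm
    change FundamentalGroup.fromPath (.mk γ) ∈ G
    rw [h1]
    refine (hG _).2 ?_
    exact (congrFun (lift_map_point hcov Γ) 1).trans Γ.target
  · exact ⟨⟨⟨lift γ, continuous_lift γ⟩, lift_zero γ, (hG γ).1 h⟩, .refl _⟩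

end PathCover

end CoveringTC

/-! ### Local properties of CW complexes -/

namespace CoveringTC

open Topology Set Metric
open scoped unitInterval
open Topology.RelCWComplex (cell map openCell closedCell cellFrontier skeletonLT)

theorem _root_.Path.homotopic_of_continuous {X : Type*} [TopologicalSpace X] {x y : X}
    {γ δ : Path x y} {F : I × I → X} (hF : Continuous F) (h0 : ∀ t, F (0, t) = γ t)
    (h1 : ∀ t, F (1, t) = δ t) (hx : ∀ s, F (s, 0) = x) (hy : ∀ s, F (s, 1) = y) :
    γ.Homotopic δ :=
  ⟨{ toFun := F
     continuous_toFun := hF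
     map_zero_left := h0
     map_one_left := h1
     prop' := by
      rintro s t (rfl | rfl)
      · exact (hx s).trans γ.source.symm
      · exact (hy s).trans γ.target.symm }⟩

section CellStructure

variable {X : Type u} [TopologicalSpace X] [T2Space X] [CWComplex (univ : Set X)]

theorem isClosed_inter_closedCell_of_preimage {n : ℕ} (e : cell (univ : Set X) n) {A : Set X}
    (h : IsClosed (closedBall 0 1 ∩ map n e ⁻¹' A)) : IsClosed (A ∩ closedCell n e) := by
  have h1 : A ∩ closedCell n e = map n e '' (closedBall 0 1 ∩ map n e ⁻¹' A) := by
    rw [image_inter_preimage, inter_comm]; rfl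
  rw [h1]
  refine (IsCompact.image_of_continuousOn ?_ ((RelCWComplex.continuousOn n e).mono
    inter_subset_left)).isClosed
  exact (isCompact_closedBall _ _).of_isClosed_subset h inter_subset_left

variable (X) in
/-- A CW complex is a quotient of a disjoint union of balls, hence locally path-connected. -/
theorem locallyPathConnectedSpace_of_cwComplex : LocallyPathConnectedSpace X := by
  let f : (Σ ni : (Σ n, cell (univ : Set X) n), closedBall (0 : Fin ni.1 → ℝ) 1) → X :=
    fun a => map a.1.1 a.1.2 a.2
  have : ∀ ni : (Σ n, cell (univ : Set X) n),
      LocallyPathConnectedSpace (closedBall (0 : Fin ni.1 → ℝ) 1) :=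
    fun ni => (convex_closedBall _ _).locallyPathConnectedSpace
  refine IsQuotientMap.locallyPathConnectedSpace (f := f) (isQuotientMap_iff_isClosed.2
    ⟨fun x => ?_, fun A => ?_⟩)
  · have hx : x ∈ (univ : Set X) := trivial
    rw [← CWComplex.union (C := (univ : Set X))] at hx
    simp only [mem_iUnion] at hx
    obtain ⟨n, i, y, hy, rfl⟩ := hx
    exact ⟨⟨⟨n, i⟩, ⟨y, hy⟩⟩, rfl⟩
  · have hf : Continuous f := continuous_sigma fun ni =>
      (RelCWComplex.continuousOn ni.1 ni.2).domRestrict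
    refine ⟨fun h => h.preimage hf, fun h => ?_⟩
    rw [isClosed_sigma_iff] at h
    refine (CWComplex.closed univ A (subset_univ _)).2 fun n e =>
      isClosed_inter_closedCell_of_preimage e ?_
    have := isClosed_closedBall.isClosedEmbedding_subtypeVal.isClosedMap _ (h ⟨n, e⟩)
    refine Eq.subst (motive := IsClosed) (Set.ext fun y => ?_) this
    refine Iff.symm ⟨?_, ?_⟩
    · exact fun hy => ⟨⟨y, hy.1⟩, hy.2, rfl⟩
    · rintro ⟨⟨y, hy⟩, hA, rfl⟩
      exact ⟨hy, hA⟩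

/-- A map on an open subset of a skeleton is continuous if it is so on every cell. -/
theorem continuousOn_inter_skeletonLT {Z : Type*} [TopologicalSpace Z] {f : X → Z} {U : Set X}
    (hU : IsOpen U) (m : ℕ) (h : ∀ n < m, ∀ e : cell (univ : Set X) n,
      ContinuousOn (f ∘ map n e) (closedBall 0 1 ∩ map n e ⁻¹' U)) :
    ContinuousOn f (U ∩ skeletonLT (univ : Set X) m) := by
  rw [_root_.continuousOn_iff']
  intro V hV
  refine ⟨(↑(skeletonLT (univ : Set X) m) \ (U ∩ f ⁻¹' V))ᶜ, isOpen_compl_iff.2 ?_, ?_⟩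
  · refine CWComplex.isClosed_of_disjoint_openCell_or_isClosed_inter_closedCell (C := univ)
      (subset_univ _) fun n _ e => ?_
    rcases lt_or_ge n m with hnm | hnm
    · refine .inr (isClosed_inter_closedCell_of_preimage e ?_)
      obtain ⟨O, hO, hO'⟩ := _root_.continuousOn_iff'.1 (h n hnm e) V hV
      obtain ⟨O', hO'o, hO''⟩ := _root_.continuousOn_iff'.1 (RelCWComplex.continuousOn n e) U hU
      refine Eq.subst (motive := IsClosed) (Set.ext fun y => ?_)
        (isClosed_closedBall (x := (0 : Fin n → ℝ)) (ε := 1) |>.sdiff (hO.inter hO'o))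
      have h1 := Set.ext_iff.1 hO' y
      have h2 := Set.ext_iff.1 hO'' y
      have h3 : y ∈ closedBall 0 1 → map n e y ∈ (skeletonLT (univ : Set X) m : Set X) :=
        fun hy => RelCWComplex.skeletonLT_mono (by exact_mod_cast hnm)
          (RelCWComplex.closedCell_subset_skeletonLT n e ⟨y, hy, rfl⟩)
      simp only [mem_inter_iff, mem_preimage, Function.comp_apply, mem_sdiff] at h1 h2 ⊢
      tauto
    · refine .inl (Disjoint.mono_left sdiff_subset ?_)
      exact RelCWComplex.disjoint_skeletonLT_openCell (by exact_mod_cast hnm)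
  · ext x
    simp only [mem_inter_iff, mem_preimage, mem_compl_iff, mem_sdiff]
    tauto

/-- A compact subset of a CW complex lies in a skeleton. -/
theorem exists_subset_skeletonLT {K : Set X} (hK : IsCompact K) :
    ∃ m : ℕ, K ⊆ skeletonLT (univ : Set X) m := by
  by_contra! hcon
  choose z hzK hz using fun m => not_subset.1 (hcon m)
  -- the sets `{z j | m ≤ j}` are closed and decreasing with empty intersection
  have hcl : ∀ m, IsClosed (z '' Ici m) := fun m => by
    refine (CWComplex.closed univ _ (subset_univ _)).2 fun n e => Set.Finite.isClosed ?_
    refine ((finite_lt_nat (n + 1)).image z).subset ?_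
    rintro _ ⟨⟨j, -, rfl⟩, hj⟩
    refine ⟨j, ?_, rfl⟩
    by_contra hnj
    refine hz j (RelCWComplex.skeletonLT_mono ?_ (RelCWComplex.closedCell_subset_skeletonLT n e hj))
    exact_mod_cast not_lt.1 hnj
  obtain ⟨m, hm⟩ := hK.elim_directed_cover (fun m => (z '' Ici m)ᶜ) (fun m => (hcl m).isOpen_compl)
    (fun x _ => by
      have hx : x ∈ (univ : Set X) := trivial
      rw [← RelCWComplex.iUnion_skeletonLT_eq_complex (C := (univ : Set X))] at hx
      obtain ⟨m, hm⟩ := mem_iUnion.1 hx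
      refine mem_iUnion.2 ⟨m, ?_⟩
      rintro ⟨j, hj, rfl⟩
      exact hz j (RelCWComplex.skeletonLT_mono (by exact_mod_cast hj) hm))
    (directed_of_isDirected_le fun i j hij =>
      compl_subset_compl.2 (image_mono (Ici_subset_Ici.2 hij)))
  exact hm (hzK m) ⟨m, self_mem_Ici, rfl⟩

theorem lt_of_mem_openCell_of_mem_skeletonLT {n m : ℕ} {e : cell (univ : Set X) n} {x : X}
    (hx : x ∈ openCell n e) (hx' : x ∈ (skeletonLT (univ : Set X) m : Set X)) : n < m := by
  by_contra h
  exact (RelCWComplex.disjoint_skeletonLT_openCell (by exact_mod_cast not_lt.1 h)).le_bot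
    ⟨hx', hx⟩

omit [T2Space X] in
/-- A point of a CW complex lies in just one open cell and has just one preimage there. -/
theorem eq_of_map_eq_map {n n' : ℕ} {e : cell (univ : Set X) n} {e' : cell (univ : Set X) n'}
    {y : Fin n → ℝ} {y' : Fin n' → ℝ} (hy : y ∈ ball 0 1) (hy' : y' ∈ ball 0 1)
    (h : map n e y = map n' e' y') :
    (⟨⟨n, e⟩, y⟩ : Σ c : (Σ n, cell (univ : Set X) n), (Fin c.1 → ℝ)) = ⟨⟨n', e'⟩, y'⟩ := by
  have h1 : (⟨n, e⟩ : Σ n, cell (univ : Set X) n) = ⟨n', e'⟩ :=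
    RelCWComplex.eq_of_not_disjoint_openCell
      (not_disjoint_iff.2 ⟨_, ⟨y, hy, rfl⟩, h ▸ ⟨y', hy', rfl⟩⟩)
  cases h1
  rw [(map n e).injOn (by rwa [RelCWComplex.source_eq]) (by rwa [RelCWComplex.source_eq]) h]

section StarNhd

/-- An open neighbourhood of the open cell `i`, built up skeleton by skeleton: besides the cell, it
contains the points `y` in the outer half of any further cell whose radial projection `y / ‖y‖` to
the boundary is already attached inside the neighbourhood. -/
inductive StarNhd {k : ℕ} (i : cell (univ : Set X) k) : X → Prop
  | base (y : Fin k → ℝ) (hy : y ∈ ball 0 1) : StarNhd i (map k i y)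
  | collar (n : ℕ) (e : cell (univ : Set X) n) (y : Fin n → ℝ) (hy : y ∈ ball 0 1)
      (hy' : 1 / 2 < ‖y‖) (h : StarNhd i (map n e (‖y‖⁻¹ • y))) : StarNhd i (map n e y)

variable {k : ℕ} {i : cell (univ : Set X) k}

theorem inv_norm_smul_mem_sphere {n : ℕ} {y : Fin n → ℝ} (hy : 1 / 2 < ‖y‖) :
    ‖y‖⁻¹ • y ∈ sphere (0 : Fin n → ℝ) 1 := by
  have : ‖y‖ ≠ 0 := by linarith
  simp [norm_smul, this]

omit [T2Space X] in
/-- The star neighbourhood in terms of the characteristic maps, on closed balls: boundary points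
satisfy the second alternative, as they are their own radial projections. -/
theorem starNhd_map_iff {n : ℕ} {e : cell (univ : Set X) n} {y : Fin n → ℝ}
    (hy : y ∈ closedBall 0 1) :
    StarNhd i (map n e y) ↔ ((⟨n, e⟩ : Σ n, cell (univ : Set X) n) = ⟨k, i⟩ ∧ ‖y‖ < 1) ∨
      (1 / 2 < ‖y‖ ∧ StarNhd i (map n e (‖y‖⁻¹ • y))) := by
  rcases (mem_closedBall_zero_iff.1 hy).lt_or_eq with hy1 | hy1
  · have hyb : y ∈ ball 0 1 := mem_ball_zero_iff.2 hy1
    constructor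
    · intro h
      generalize hz : map n e y = z at h
      cases h with
      | base y' hy' =>
        cases eq_of_map_eq_map hyb hy' hz
        exact .inl ⟨rfl, hy1⟩
      | collar n' e' y' hy' hy2 h =>
        cases eq_of_map_eq_map hyb hy' hz
        exact .inr ⟨hy2, h⟩
    · rintro (⟨h, -⟩ | ⟨h, h'⟩)
      · cases h
        exact .base y hyb
      · exact .collar n e y hyb h h'
  · simp only [hy1, inv_one, one_smul]
    norm_num

/-- By induction on the dimension, the complement meets each closed cell in a closed set: its trace
on the boundary of the cell is closed, and determines its trace on the cell. -/
theorem isOpen_starNhd : IsOpen {x | StarNhd i x} := by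
  rw [← isClosed_compl_iff]
  have key : ∀ n, ∀ e : cell (univ : Set X) n,
      IsClosed ({x | StarNhd i x}ᶜ ∩ closedCell n e) := by
    intro n
    induction n using Nat.strong_induction_on with | h n ih => ?_
    intro e
    have hfr : IsClosed ({x | StarNhd i x}ᶜ ∩ cellFrontier n e) := by
      cases n with
      | zero => simp [RelCWComplex.cellFrontier_zero_eq_empty]
      | succ n =>
        exact CWComplex.isClosed_inter_cellFrontier_succ_of_le_isClosed_inter_closedCell
          (fun m hm j => ih m (Nat.lt_succ_of_le hm) j) e
    refine isClosed_inter_closedCell_of_preimage e ?_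
    have hO : IsOpen {y : Fin n → ℝ | 1 / 2 < ‖y‖} := isOpen_lt continuous_const continuous_norm
    have hcont : ContinuousOn (fun y : Fin n → ℝ => map n e (‖y‖⁻¹ • y)) {y | 1 / 2 < ‖y‖} := by
      refine (RelCWComplex.continuousOn n e).comp ?_
        fun y hy => sphere_subset_closedBall (inv_norm_smul_mem_sphere hy)
      refine (continuousOn_id.norm.inv₀ fun y hy => ?_).smul continuousOn_id
      have : (1 : ℝ) / 2 < ‖y‖ := hy
      simp only [id]
      linarith
    have h1 := hcont.isOpen_inter_preimage hO hfr.isOpen_compl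
    have h2 : IsOpen {y : Fin n → ℝ | (⟨n, e⟩ : Σ n, cell (univ : Set X) n) = ⟨k, i⟩ ∧ ‖y‖ < 1} :=
      isOpen_const.and (isOpen_lt continuous_norm continuous_const)
    refine Eq.subst (motive := IsClosed) (Set.ext fun y => ?_)
      (isClosed_closedBall (x := (0 : Fin n → ℝ)) (ε := 1) |>.sdiff (h2.union h1))
    simp only [mem_sdiff, mem_union, mem_inter_iff, mem_preimage, mem_compl_iff, mem_ofPred_eq]
    refine and_congr_right fun hy => not_congr ?_
    rw [starNhd_map_iff hy]
    refine or_congr Iff.rfl (and_congr_right fun hy' => ?_)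
    have : map n e (‖y‖⁻¹ • y) ∈ cellFrontier n e := ⟨_, inv_norm_smul_mem_sphere hy', rfl⟩
    tauto
  exact (CWComplex.closed univ _ (subset_univ _)).2 key

theorem StarNhd.notMem_skeletonLT {z : X} (h : StarNhd i z) :
    z ∉ (skeletonLT (univ : Set X) k : Set X) := by
  induction h with
  | base y hy => exact fun h => lt_irrefl _ (lt_of_mem_openCell_of_mem_skeletonLT ⟨y, hy, rfl⟩ h)
  | collar n e y hy hy' _ ih =>
    refine fun h => ih (RelCWComplex.skeletonLT_mono ?_ (RelCWComplex.cellFrontier_subset_skeletonLT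
      n e ⟨_, inv_norm_smul_mem_sphere hy', rfl⟩))
    exact_mod_cast (lt_of_mem_openCell_of_mem_skeletonLT ⟨y, hy, rfl⟩ h).le

/-- In the lowest skeleton that it meets, the star neighbourhood is just the open cell. -/
theorem StarNhd.mem_openCell {z : X} (h : StarNhd i z)
    (hz : z ∈ (skeletonLT (univ : Set X) (k + 1 : ℕ) : Set X)) : z ∈ openCell k i := by
  cases h with
  | base y hy => exact ⟨y, hy, rfl⟩
  | collar n e y hy hy' h =>
    refine absurd (RelCWComplex.skeletonLT_mono ?_ (RelCWComplex.cellFrontier_subset_skeletonLT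
      n e ⟨_, inv_norm_smul_mem_sphere hy', rfl⟩)) h.notMem_skeletonLT
    exact_mod_cast Nat.lt_succ_iff.1 (lt_of_mem_openCell_of_mem_skeletonLT ⟨y, hy, rfl⟩ hz)

end StarNhd

section RadialPush

theorem lineMap_inv_norm_smul_mem_closedBall {n : ℕ} {y : Fin n → ℝ} (hy : y ∈ closedBall 0 1)
    (t : I) : AffineMap.lineMap y (‖y‖⁻¹ • y) (t : ℝ) ∈ closedBall (0 : Fin n → ℝ) 1 := by
  refine (convex_closedBall _ _).lineMap_mem hy ?_ t.2
  rw [mem_closedBall_zero_iff, norm_smul, norm_inv, norm_norm]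
  exact inv_mul_le_one

open Classical in
/-- The path that moves a point of an open `m`-cell radially to the boundary of the cell; the path
is constant for points outside the open `m`-cells, and for the centres. -/
noncomputable def radialPush (m : ℕ) (z : X) : C(I, X) :=
  if h : ∃ e : cell (univ : Set X) m, ∃ y ∈ ball (0 : Fin m → ℝ) 1, map m e y = z then
    ⟨fun t => map m h.choose (AffineMap.lineMap h.choose_spec.choose
        (‖h.choose_spec.choose‖⁻¹ • h.choose_spec.choose) (t : ℝ)),
      (RelCWComplex.continuousOn m h.choose).comp_continuous (by fun_prop)
        fun t => lineMap_inv_norm_smul_mem_closedBall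
          (ball_subset_closedBall h.choose_spec.choose_spec.1) t⟩
  else .const I z

theorem radialPush_of_mem_skeletonLT {m : ℕ} {z : X}
    (hz : z ∈ (skeletonLT (univ : Set X) m : Set X)) : radialPush m z = .const I z := by
  refine dif_neg ?_
  rintro ⟨e, y, hy, rfl⟩
  exact lt_irrefl _ (lt_of_mem_openCell_of_mem_skeletonLT ⟨y, hy, rfl⟩ hz)

/-- The formula for the radial path holds up to the boundary of the cell, where the path is
constant. -/
theorem radialPush_map {m : ℕ} (e : cell (univ : Set X) m) {y : Fin m → ℝ}
    (hy : y ∈ closedBall 0 1) (t : I) :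
    radialPush m (map m e y) t = map m e (AffineMap.lineMap y (‖y‖⁻¹ • y) (t : ℝ)) := by
  rcases (mem_closedBall_zero_iff.1 hy).lt_or_eq with hy1 | hy1
  · have hyb : y ∈ ball 0 1 := mem_ball_zero_iff.2 hy1
    have h : ∃ e' : cell (univ : Set X) m, ∃ y' ∈ ball (0 : Fin m → ℝ) 1, map m e' y' = map m e y :=
      ⟨e, y, hyb, rfl⟩
    rw [radialPush, dif_pos h]
    have := eq_of_map_eq_map h.choose_spec.choose_spec.1 hyb h.choose_spec.choose_spec.2
    have hgen : ∀ (e' : cell (univ : Set X) m) (y' : Fin m → ℝ),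
        (⟨⟨m, e'⟩, y'⟩ : Σ c : (Σ n, cell (univ : Set X) n), (Fin c.1 → ℝ)) = ⟨⟨m, e⟩, y⟩ →
        map m e' (AffineMap.lineMap y' (‖y'‖⁻¹ • y') (t : ℝ)) =
          map m e (AffineMap.lineMap y (‖y‖⁻¹ • y) (t : ℝ)) := by
      rintro e' y' h
      cases h
      rfl
    exact hgen _ _ this
  · rw [radialPush_of_mem_skeletonLT (RelCWComplex.cellFrontier_subset_skeletonLT m e
      ⟨y, mem_sphere_zero_iff_norm.2 hy1, rfl⟩)]
    simp [hy1]

/-- Where the centres of the `m`-cells are avoided, the radial path depends continuously on its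
starting point, even across the boundary of the cells, since it is constant there. -/
theorem continuousOn_radialPush {m : ℕ} {U : Set X} (hU : IsOpen U)
    (h : ∀ (e : cell (univ : Set X) m), ∀ y ∈ closedBall (0 : Fin m → ℝ) 1, map m e y ∈ U →
      1 / 2 < ‖y‖) :
    ContinuousOn (radialPush m) (U ∩ skeletonLT (univ : Set X) (m + 1 : ℕ)) := by
  refine continuousOn_inter_skeletonLT hU (m + 1) fun n hn e => ?_
  rcases (Nat.lt_succ_iff.1 hn).lt_or_eq with hnm | rfl
  · have h1 : ContinuousOn (fun y => ContinuousMap.const I (map n e y)) (closedBall 0 1) :=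
      ContinuousMap.continuous_const'.comp_continuousOn (RelCWComplex.continuousOn n e)
    refine (h1.mono inter_subset_left).congr fun y hy => radialPush_of_mem_skeletonLT ?_
    exact RelCWComplex.skeletonLT_mono (by exact_mod_cast hnm)
      (RelCWComplex.closedCell_subset_skeletonLT n e ⟨y, hy.1, rfl⟩)
  · rw [continuousOn_iff_continuous_domRestrict]
    let T : Set (Fin n → ℝ) := closedBall 0 1 ∩ map n e ⁻¹' U
    have hT : ∀ y : T, ‖(y : Fin n → ℝ)‖ ≠ 0 := fun y => by
      have := h e y y.2.1 y.2.2
      linarith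
    let g : C(T × I, X) := ⟨fun a => map n e (AffineMap.lineMap (a.1 : Fin n → ℝ)
      (‖(a.1 : Fin n → ℝ)‖⁻¹ • (a.1 : Fin n → ℝ)) (a.2 : ℝ)), by
        refine (RelCWComplex.continuousOn n e).comp_continuous ?_
          fun a => lineMap_inv_norm_smul_mem_closedBall a.1.2.1 a.2
        have h1 : Continuous fun a : T × I => ‖(a.1 : Fin n → ℝ)‖⁻¹ :=
          Continuous.inv₀ (by fun_prop) fun a => hT a.1
        simp only [AffineMap.lineMap_apply]
        fun_prop⟩
    convert g.curry.continuous using 1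
    ext y t
    exact radialPush_map e y.2.1 t

end RadialPush

omit [T2Space X] in
theorem homotopic_refl_of_range_subset_openCell {k : ℕ} {i : cell (univ : Set X) k} {x : X}
    (γ : Path x x) (h : range γ ⊆ openCell k i) : γ.Homotopic (.refl x) := by
  have ht : (map k i).target = openCell k i := by
    rw [← (map k i).image_source_eq_target, RelCWComplex.source_eq]; rfl
  rw [← ht] at h
  have hmem : ∀ t, (map k i).symm (γ t) ∈ ball (0 : Fin k → ℝ) 1 := fun t => by
    rw [← RelCWComplex.source_eq k i]
    exact (map k i).map_target (h ⟨t, rfl⟩)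
  have hw : Continuous fun t => (map k i).symm (γ t) :=
    (RelCWComplex.continuousOn_symm k i).comp_continuous γ.continuous fun t => h ⟨t, rfl⟩
  have hi : ∀ t, map k i ((map k i).symm (γ t)) = γ t := fun t =>
    (map k i).right_inv (h ⟨t, rfl⟩)
  refine Path.homotopic_of_continuous (F := fun a => map k i (AffineMap.lineMap
    ((map k i).symm (γ a.2)) ((map k i).symm (γ 0)) (a.1 : ℝ))) ?_ ?_ ?_ ?_ ?_
  · refine (RelCWComplex.continuousOn k i).comp_continuous ?_
      fun a => (convex_closedBall _ _).lineMap_mem (ball_subset_closedBall (hmem _))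
        (ball_subset_closedBall (hmem _)) a.1.2
    have h2 : Continuous fun a : I × I => (map k i).symm (γ a.2) := hw.comp continuous_snd
    simp only [AffineMap.lineMap_apply]
    fun_prop
  · intro t; simp [hi]
  · intro t; simpa using hi 0
  · intro s; simpa using hi 0
  · intro s; simpa using hi 0

/-- A loop in the star neighbourhood is compact, so it lies in a skeleton; it is pushed radially
down, one skeleton at a time, into the open cell, where it contracts. -/
theorem homotopic_refl_of_range_subset_starNhd {k : ℕ} {i : cell (univ : Set X) k} {x : X}
    (hx : x ∈ openCell k i) (γ : Path x x) (h : ∀ t, StarNhd i (γ t)) : γ.Homotopic (.refl x) := by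
  have key : ∀ j : ℕ, ∀ γ : Path x x, (∀ t, StarNhd i (γ t)) →
      (∀ t, γ t ∈ (skeletonLT (univ : Set X) (k + 1 + j : ℕ) : Set X)) →
      γ.Homotopic (.refl x) := by
    intro j
    induction j with
    | zero =>
      exact fun γ h h' => homotopic_refl_of_range_subset_openCell γ
        (range_subset_iff.2 fun t => (h t).mem_openCell (h' t))
    | succ j ih =>
      intro γ h h'
      set m := k + 1 + j with hm
      have hnorm : ∀ (e : cell (univ : Set X) m), ∀ y ∈ closedBall (0 : Fin m → ℝ) 1,
          StarNhd i (map m e y) → 1 / 2 < ‖y‖ ∧ StarNhd i (map m e (‖y‖⁻¹ • y)) := by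
        intro e y hy hs
        refine ((starNhd_map_iff hy).1 hs).resolve_left ?_
        rintro ⟨heq, -⟩
        have : m = k := congrArg Sigma.fst heq
        omega
      have hc : Continuous fun t => radialPush m (γ t) :=
        (continuousOn_radialPush isOpen_starNhd fun e y hy hs =>
          (hnorm e y hy hs).1).comp_continuous γ.continuous fun t => ⟨h t, h' t⟩
      have hxm : radialPush m x = .const I x := radialPush_of_mem_skeletonLT
        (RelCWComplex.skeletonLT_mono (by norm_cast; omega)
          (RelCWComplex.openCell_subset_skeletonLT k i hx))
      have h01 : ∀ t, radialPush m (γ t) 0 = γ t ∧ StarNhd i (radialPush m (γ t) 1) ∧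
          radialPush m (γ t) 1 ∈ (skeletonLT (univ : Set X) m : Set X) := by
        intro t
        have h1 : γ t ∈ (skeletonLT (univ : Set X) (m + 1 : ℕ) : Set X) := h' t
        rw [Nat.cast_add_one, ← RelCWComplex.skeletonLT_union_iUnion_closedCell_eq_skeletonLT_succ,
          mem_union, mem_iUnion] at h1
        -- on cells of dimension below `m` the path is constant, on an `m`-cell it is radial
        rcases h1 with h1 | ⟨e, y, hy, h1⟩
        · rw [radialPush_of_mem_skeletonLT h1]
          exact ⟨rfl, h t, h1⟩
        · have h2 := hnorm e y hy (h1 ▸ h t)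
          rw [← h1, radialPush_map e hy, radialPush_map e hy]
          simp only [Set.Icc.coe_zero, Set.Icc.coe_one, AffineMap.lineMap_apply_zero,
            AffineMap.lineMap_apply_one]
          exact ⟨trivial, h2.2, RelCWComplex.cellFrontier_subset_skeletonLT m e
            ⟨_, inv_norm_smul_mem_sphere h2.1, rfl⟩⟩
      let γ' : Path x x :=
        { toFun := fun t => radialPush m (γ t) 1
          continuous_toFun := (continuous_eval_const 1).comp hc
          source' := by simp [hxm]
          target' := by simp [hxm] }
      refine Path.Homotopic.trans ?_ (ih γ' (fun t => (h01 t).2.1) fun t => (h01 t).2.2)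
      refine Path.homotopic_of_continuous (F := fun a => radialPush m (γ a.2) a.1) ?_
        (fun t => (h01 t).1) (fun t => rfl) (fun s => by simp [hxm]) fun s => by simp [hxm]
      exact (hc.comp continuous_snd).eval continuous_fst
  obtain ⟨m, hm⟩ := exists_subset_skeletonLT (isCompact_range γ.continuous)
  exact key m γ h fun t =>
    RelCWComplex.skeletonLT_mono (by norm_cast; omega) (hm ⟨t, rfl⟩)

/-- CW complexes are semilocally simply connected: every point has a star neighbourhood. -/
theorem exists_isRelativelySimplyConnected [LocallyPathConnectedSpace X] (x : X) :
    ∃ U : Set X, x ∈ U ∧ IsRelativelySimplyConnected U := by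
  have hx : x ∈ (univ : Set X) := trivial
  rw [← CWComplex.iUnion_openCell_eq_complex (C := (univ : Set X))] at hx
  simp only [mem_iUnion] at hx
  obtain ⟨k, i, hx⟩ := hx
  have hxU : x ∈ {z | StarNhd i z} := by
    obtain ⟨y, hy, rfl⟩ := hx
    exact .base y hy
  refine ⟨pathComponentIn {z | StarNhd i z} x, mem_pathComponentIn_self hxU,
    isOpen_starNhd.pathComponentIn x, isPathConnected_pathComponentIn hxU, ?_⟩
  intro y z γ δ hγ hδ
  obtain ⟨ρ, hρ⟩ : JoinedIn {z | StarNhd i z} x y := γ.source ▸ hγ ⟨0, rfl⟩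
  -- the loop running along `ρ`, `γ`, back along `δ` and `ρ` is null-homotopic
  have h1 := homotopic_refl_of_range_subset_starNhd hx ((ρ.trans γ).trans (ρ.trans δ).symm) (by
    have : range ((ρ.trans γ).trans (ρ.trans δ).symm) ⊆ {z | StarNhd i z} := by
      have hγ' := hγ.trans pathComponentIn_subset
      have hδ' := hδ.trans pathComponentIn_subset
      have hρ' := range_subset_iff.2 hρ
      simp only [Path.trans_range, Path.symm_range, union_subset_iff]
      exact ⟨⟨hρ', hγ'⟩, hρ', hδ'⟩
    exact range_subset_iff.1 this)
  have h2 := Path.Homotopic.Quotient.eq.2 h1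
  rw [Path.trans_symm] at h2
  simp only [Path.Homotopic.Quotient.mk_trans, Path.Homotopic.Quotient.mk_symm,
    Path.Homotopic.Quotient.mk_refl] at h2
  refine Path.Homotopic.Quotient.exact ?_
  have h3 := congrArg (fun a => (Path.Homotopic.Quotient.mk ρ).symm.trans
    (a.trans ((Path.Homotopic.Quotient.mk ρ).trans (.mk δ)))) h2
  simpa [Path.Homotopic.Quotient.symm_trans_trans] using h3

end CellStructure

end CoveringTC

/-! ### The complexity as a function of the subgroup -/

theorem mainTheorem11 (X : Type u) [TopologicalSpace X] [T2Space X]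
    [Topology.CWComplex (Set.univ : Set X)] [PathConnectedSpace X] (x₀ : X) :
    -- every subgroup is the image of the fundamental group of some pointed covering
    (∀ G : Subgroup (FundamentalGroup X x₀),
      ∃ p : CoveringTC.PointedCovering X x₀, p.subgroup = G) ∧
    -- in particular there is a universal covering
    (∃ p : CoveringTC.PointedCovering X x₀, SimplyConnectedSpace p.Total) ∧
    ∃ τ : Subgroup (FundamentalGroup X x₀) → ℕ∞,
      -- the complexity of a covering projection depends only on its subgroup
      (∀ p : CoveringTC.PointedCovering X x₀, CoveringTC.mapTC p.proj = τ p.subgroup) ∧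
      Monotone τ ∧
      -- the minimum is attained at the trivial subgroup, by the universal covering
      (∀ p : CoveringTC.PointedCovering X x₀, SimplyConnectedSpace p.Total →
        p.subgroup = ⊥ ∧ CoveringTC.mapTC p.proj = τ ⊥ ∧
          IsLeast (Set.range τ) (CoveringTC.mapTC p.proj)) ∧
      -- the maximum is attained at the whole group, by the identity map
      τ ⊤ = CoveringTC.mapTC (ContinuousMap.id X) ∧
      τ ⊤ = CoveringTC.spaceTC X ∧
      IsGreatest (Set.range τ) (CoveringTC.spaceTC X) := by
  have hlpc : LocallyPathConnectedSpace X := CoveringTC.locallyPathConnectedSpace_of_cwComplex X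
  have hex : ∀ G : Subgroup (FundamentalGroup X x₀),
      ∃ p : CoveringTC.PointedCovering X x₀, p.subgroup = G := fun G =>
    CoveringTC.exists_pointedCovering G CoveringTC.exists_isRelativelySimplyConnected
  choose cov hcov using hex
  have hdep : ∀ p : CoveringTC.PointedCovering X x₀,
      CoveringTC.mapTC p.proj = CoveringTC.mapTC (cov p.subgroup).proj := fun p =>
    (p.mapTC_mono _ (hcov _).ge).antisymm ((cov p.subgroup).mapTC_mono p (hcov _).le)
  have hmono : Monotone fun G => CoveringTC.mapTC (cov G).proj := fun G G' h =>
    (cov G).mapTC_mono (cov G') (by rwa [hcov, hcov])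
  have htop : CoveringTC.mapTC (cov ⊤).proj = CoveringTC.mapTC (ContinuousMap.id X) := by
    rw [← CoveringTC.PointedCovering.subgroup_refl x₀, ← hdep]
    rfl
  refine ⟨fun G => ⟨cov G, hcov G⟩,
    ⟨cov ⊥, (cov ⊥).simplyConnectedSpace_of_subgroup_eq_bot (hcov ⊥)⟩,
    fun G => CoveringTC.mapTC (cov G).proj, hdep, hmono, fun p hp => ?_, htop, htop,
    ⟨⊤, htop⟩, ?_⟩
  · have hbot := p.subgroup_eq_bot
    have hp' : CoveringTC.mapTC p.proj = CoveringTC.mapTC (cov ⊥).proj := hbot ▸ hdep p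
    refine ⟨hbot, hp', ⟨⊥, hp'.symm⟩, ?_⟩
    rintro _ ⟨G, rfl⟩
    exact hp'.trans_le (hmono bot_le)
  · rintro _ ⟨G, rfl⟩
    exact (hmono le_top).trans_eq htop
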